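/- For a field $k$, define an absolute value on $k((X^{-1}))$ by $|0|=0$ and $|F|=2^m$ if $F=\sum_{h\ge -m} f_hX^{-h}$ with $f_{-m}\neq 0$, and let $\|F\|$ denote $|\{F\}|$, where $\{F\}=\sum_{h\ge 1}f_hX^{-h}$ is the fractional part of $F$. The polynomial $Z^4+Z^2-XZ+1$ has a unique root $\Theta$ in $\mathbf F_3((X^{-1}))$. For this $\Theta$ we have $$\inf_{q\in\mathbf F_3[X]\setminus\{0\}}|q|^2\cdot\|q\Theta\|\cdot\|q\Theta^{-1}\|<+\infty,$$ and moreover $$\liminf_{q\in\mathbf F_3[X],\ \deg q\to+\infty}|q|^2\cdot\|q\Theta\|\cdot\|q\Theta^{-1}\|<+\infty.$$ Furthermore, for every real $\varepsilon>0$ there is an integer $D$ such that $$|q|^{2+4/\sqrt{3\deg q}+\varepsilon}\cdot\|q\Theta\|\cdot\|q\Theta^{-1}\|\ge 1$$ for every $q\in\mathbf F_3[X]$ with $\deg q\ge D$, where the exponent is $2+\frac{4}{\sqrt{3\deg q}}+\varepsilon$. -/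

import Mathlib

open Filter

noncomputable section

namespace PowerSeriesField

/-- The field `k((X⁻¹))` of formal Laurent series in `X⁻¹`. An element
`F = ∑ₕ f_h X^(-h)` is stored as the Laurent series in the uniformizer `X⁻¹`, so that `f_h` is
`F.coeff h`, and only finitely many `f_h` with `h ≤ 0` are nonzero. -/
abbrev SeriesAtInfinity (k : Type*) [Field k] : Type _ := LaurentSeries k

variable {k : Type*} [Field k]

/-- The indeterminate `X`, as an element of `k((X⁻¹))`. -/
def seriesX (k : Type*) [Field k] : SeriesAtInfinity k := HahnSeries.single (-1 : ℤ) (1 : k)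

/-- The inclusion of `k[X]` in `k((X⁻¹))`, which sends constants to constants and `X` to `X`. -/
def ofPoly : Polynomial k →+* SeriesAtInfinity k :=
  Polynomial.eval₂RingHom HahnSeries.C (seriesX k)

open Classical in
/-- The absolute value on `k((X⁻¹))`: `|0| = 0`, and `|F| = 2 ^ m` if
`F = ∑_{h ≥ -m} f_h X^(-h)` with `f_{-m} ≠ 0` (that is, if `F` has order `-m` in `X⁻¹`). -/
def absInf (F : SeriesAtInfinity k) : ℝ := if F = 0 then 0 else (2 : ℝ) ^ (-F.order)

/-- The fractional part of `F`: the part of the series which comprises only the negative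
powers of `X`. -/
def fracPart (F : SeriesAtInfinity k) : SeriesAtInfinity k where
  coeff h := if 0 < h then F.coeff h else 0
  isPWO_support' := F.isPWO_support.mono (by
    intro h hh
    by_cases h0 : 0 < h <;> simp_all [Function.mem_support])

/-- `‖F‖`: the absolute value of the fractional part of `F`. -/
def distPoly (F : SeriesAtInfinity k) : ℝ := absInf (fracPart F)

end PowerSeriesField

end

/-!
In characteristic three, let `W₀` be the empty word, `W₁ = [X]` and
`Wₙ₊₂ = Wₙ₊₁, -X, Wₙ^(3), -X, Wₙ₊₁`, where `Wₙ^(3)` consists of the cubes of the entries of `Wₙ`.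
The continuant matrix of `Wₙ` is symmetric, say with rows `(q, r)` and `(r, s)`, and satisfies
`q² + q s + s² = X q r` and `q s - r² = ±1`. A triple with `q² + q s + s² = X q r` and `r² = q s`
would be proportional to `(1, Z, Z²)` with `Z⁴ + Z² - X Z + 1 = 0`, so `r / q` is nearly a root.
Since `-X Z` dominates the variation of the quartic on the unit ball, `|q Θ - r| ≤ 1 / (2 |q|)`, and
hence `Wₙ` is the start of the continued fraction of `Θ`.

Both consequences for the product `|Q|² ‖Q Θ‖ ‖Q Θ⁻¹‖` come from these convergents. For `Q = r`, the
polynomials `s` and `q` are within `1 / |q|` of `r Θ` and `r Θ⁻¹`, so the product is at most `1`.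
For the lower bound, a word whose continuant has degree `(3ⁿ - 1) / 2` has letters of degree at most
`3 ^ ((n - 1) / 2)`, so the partial quotients met by a denominator of degree `d` have degree
`O(√d)`, and the product is at least `2 ^ (-O(√d))`.
-/

noncomputable section

namespace PowerSeriesField

section Nonarchimedean

variable {R : Type*} [Ring R] {v : AbsoluteValue R ℝ} {x y : R} {c : ℝ}

lemma abv_add_le (hv : IsNonarchimedean v) (hx : v x ≤ c) (hy : v y ≤ c) : v (x + y) ≤ c :=
  (hv x y).trans (max_le hx hy)

lemma abv_sub_le (hv : IsNonarchimedean v) (hx : v x ≤ c) (hy : v y ≤ c) : v (x - y) ≤ c := by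
  rw [sub_eq_add_neg]
  exact abv_add_le hv hx ((v.map_neg y).trans_le hy)

lemma abv_add_eq_left_of_lt (hv : IsNonarchimedean v) (h : v y < v x) : v (x + y) = v x := by
  rw [hv.add_eq_max_of_ne' v (fun z => (v.map_neg z).symm) h.ne', max_eq_left h.le]

lemma abv_sub_eq_left_of_lt (hv : IsNonarchimedean v) (h : v y < v x) : v (x - y) = v x := by
  rw [sub_eq_add_neg]
  exact abv_add_eq_left_of_lt hv (by rwa [v.map_neg])

lemma abv_sub_eq_right_of_lt (hv : IsNonarchimedean v) (h : v x < v y) : v (x - y) = v y := by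
  rw [v.map_sub, abv_sub_eq_left_of_lt hv h]

end Nonarchimedean

section ContinuedFraction

variable {R : Type*} [CommRing R]

/-- The continuant matrix of a list `[a₁, …, aₙ]`: its first column holds the denominator and the
numerator of the continued fraction `1 / (a₁ + 1 / (a₂ + ⋯))`. -/
def contMatrix (L : List R) : Matrix (Fin 2) (Fin 2) R :=
  (L.map fun a => !![a, 1; 1, 0]).prod

lemma contMatrix_nil : contMatrix ([] : List R) = 1 := rfl

lemma contMatrix_cons (a : R) (L : List R) :
    contMatrix (a :: L) = !![a, 1; 1, 0] * contMatrix L := by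
  simp [contMatrix]

lemma contMatrix_append (L₁ L₂ : List R) :
    contMatrix (L₁ ++ L₂) = contMatrix L₁ * contMatrix L₂ := by
  simp [contMatrix]

lemma contMatrix_map {S : Type*} [CommRing S] (φ : R →+* S) (L : List R) :
    contMatrix (L.map φ) = (contMatrix L).map φ := by
  induction L with
  | nil => simp [contMatrix_nil]
  | cons a L ih =>
    have hφ : !![φ a, 1; 1, 0] = !![a, 1; 1, 0].map φ := by simp [← Matrix.ext_iff]
    rw [List.map_cons, contMatrix_cons, contMatrix_cons, ih, Matrix.map_mul, hφ]

lemma det_contMatrix (L : List R) : (contMatrix L).det = (-1) ^ L.length := by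
  induction L with
  | nil => simp [contMatrix_nil]
  | cons a L ih =>
    rw [contMatrix_cons, Matrix.det_mul, ih, Matrix.det_fin_two_of, List.length_cons]
    ring

lemma contMatrix_cons_zero (a : R) (L : List R) :
    contMatrix (a :: L) 0 0 = a * contMatrix L 0 0 + contMatrix L 1 0 := by
  simp [contMatrix_cons, Matrix.mul_apply, Fin.sum_univ_two]

lemma contMatrix_cons_one (a : R) (L : List R) :
    contMatrix (a :: L) 1 0 = contMatrix L 0 0 := by
  simp [contMatrix_cons, Matrix.mul_apply, Fin.sum_univ_two]

variable {v : AbsoluteValue R ℝ}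

lemma abv_mul_sub_mul_of_lt (hv : IsNonarchimedean v) {a P Q q t : R} (ha : 1 < v a)
    (ht : v t < v q) (hQ : v Q < v (P * a)) :
    v (Q * q - P * (a * q + t)) = v P * v a * v q := by
  have hQP : v (Q - P * a) = v P * v a := by
    rw [abv_sub_eq_right_of_lt hv hQ, v.map_mul]
  have hP : 0 < v P := by
    refine v.pos_iff.2 fun h => (v.nonneg Q).not_gt ?_
    rwa [h, zero_mul, v.map_zero] at hQ
  have htq : v t < v a * v q := ht.trans (lt_mul_of_one_lt_left ((v.nonneg t).trans_lt ht) ha)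
  rw [show Q * q - P * (a * q + t) = (Q - P * a) * q - P * t by ring,
    abv_sub_eq_left_of_lt hv, v.map_mul, hQP]
  rw [v.map_mul, v.map_mul, hQP, mul_assoc]
  gcongr

variable [Nontrivial R]

lemma abv_contMatrix_one_lt_zero (hv : IsNonarchimedean v) {L : List R} (hL : ∀ a ∈ L, 1 < v a) :
    v (contMatrix L 1 0) < v (contMatrix L 0 0) := by
  induction L with
  | nil => simp [contMatrix_nil]
  | cons a L ih =>
    have ht := ih fun b hb => hL b (List.mem_cons_of_mem _ hb)
    have hlt : v (contMatrix L 0 0) < v (a * contMatrix L 0 0) := by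
      rw [v.map_mul]
      exact lt_mul_of_one_lt_left ((v.nonneg _).trans_lt ht) (hL a List.mem_cons_self)
    rwa [contMatrix_cons_zero, contMatrix_cons_one, abv_add_eq_left_of_lt hv (ht.trans hlt)]

lemma abv_contMatrix_cons_zero (hv : IsNonarchimedean v) {a : R} {L : List R}
    (hL : ∀ b ∈ a :: L, 1 < v b) :
    v (contMatrix (a :: L) 0 0) = v a * v (contMatrix L 0 0) := by
  have ha : 1 < v a := hL a List.mem_cons_self
  have ht := abv_contMatrix_one_lt_zero hv fun b hb => hL b (List.mem_cons_of_mem a hb)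
  rw [contMatrix_cons_zero, abv_add_eq_left_of_lt hv, v.map_mul]
  rw [v.map_mul]
  exact ht.trans (lt_mul_of_one_lt_left ((v.nonneg _).trans_lt ht) ha)

/-- In other words, `|t / q - P / Q| ≥ 1 / (c |Q|²)`, where `t / q` is the continued fraction `L`.
The induction removes the first partial quotient `a` and replaces `P / Q` by `(Q - P a) / P`. -/
lemma abv_contMatrix_le_mul (hv : IsNonarchimedean v) (hv₁ : ∀ x, x ≠ 0 → 1 ≤ v x) {c : ℝ}
    {L : List R} (hL : ∀ a ∈ L, 1 < v a ∧ v a ≤ c) {Q : R} (hQ : Q ≠ 0)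
    (hQL : v Q < v (contMatrix L 0 0)) (P : R) :
    v (contMatrix L 0 0) ≤ v (Q * contMatrix L 1 0 - P * contMatrix L 0 0) * v Q * c := by
  induction L generalizing Q P with
  | nil => exact absurd (hv₁ Q hQ) (by simpa [contMatrix_nil] using hQL)
  | cons a L ih =>
    obtain ⟨ha, hac⟩ := hL a List.mem_cons_self
    have hL' : ∀ b ∈ L, 1 < v b ∧ v b ≤ c := fun b hb => hL b (List.mem_cons_of_mem a hb)
    have ht := abv_contMatrix_one_lt_zero hv fun b hb => (hL' b hb).1
    rw [abv_contMatrix_cons_zero hv fun b hb => (hL b hb).1] at hQL ⊢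
    rw [contMatrix_cons_zero, contMatrix_cons_one]
    set q := contMatrix L 0 0
    set t := contMatrix L 1 0
    have hq : 0 < v q := (v.nonneg _).trans_lt ht
    have hQ₁ := hv₁ Q hQ
    rcases eq_or_ne P 0 with rfl | hP
    · calc v a * v q ≤ c * (v q * (v Q * v Q)) := by
            have hQQ := one_le_mul_of_one_le_of_one_le hQ₁ hQ₁
            exact mul_le_mul hac (le_mul_of_one_le_right hq.le hQQ) hq.le ((v.nonneg a).trans hac)
        _ = v (Q * q - 0 * (a * q + t)) * v Q * c := by
            rw [zero_mul, sub_zero, v.map_mul]; ring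
    have hP₁ := hv₁ P hP
    rcases lt_or_ge (v Q) (v (P * a)) with hlt | hge
    · calc v a * v q ≤ v P * (v a * v q) := le_mul_of_one_le_left (by positivity) hP₁
        _ ≤ v P * (v a * v q) * (v Q * c) :=
            le_mul_of_one_le_right (by positivity)
              (one_le_mul_of_one_le_of_one_le hQ₁ (ha.le.trans hac))
        _ = v (Q * q - P * (a * q + t)) * v Q * c := by
            rw [abv_mul_sub_mul_of_lt hv ha ht hlt]; ring
    · rw [v.map_mul] at hge
      have hPq : v P < v q := by
        refine lt_of_mul_lt_mul_right (a := v a) ?_ (v.nonneg a)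
        linarith [mul_comm (v a) (v q)]
      have hrec := ih hL' hP hPq (Q - P * a)
      rw [show Q * q - P * (a * q + t) = (Q - P * a) * q - P * t by ring, v.map_sub]
      calc v a * v q ≤ v a * (v (P * t - (Q - P * a) * q) * v P * c) := by gcongr
        _ = v (P * t - (Q - P * a) * q) * (v P * v a) * c := by ring
        _ ≤ v (P * t - (Q - P * a) * q) * v Q * c := by
            have hc : 0 ≤ c := (v.nonneg a).trans hac
            gcongr

end ContinuedFraction

section AbsoluteValue

variable {k : Type*} [Field k]

lemma absInf_of_ne_zero {F : SeriesAtInfinity k} (hF : F ≠ 0) :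
    absInf F = (2 : ℝ) ^ (-F.order) :=
  if_neg hF

lemma absInf_nonneg (F : SeriesAtInfinity k) : 0 ≤ absInf F := by
  rw [absInf]
  split_ifs <;> positivity

lemma isNonarchimedean_absInf : IsNonarchimedean (absInf (k := k)) := by
  intro F G
  by_cases hF : F = 0
  · simp [hF]
  by_cases hG : G = 0
  · simp [hG]
  by_cases h : F + G = 0
  · rw [h, absInf, if_pos rfl]
    exact le_max_of_le_left (absInf_nonneg F)
  rw [absInf_of_ne_zero hF, absInf_of_ne_zero hG, absInf_of_ne_zero h, le_max_iff,
    zpow_le_zpow_iff_right₀ one_lt_two, zpow_le_zpow_iff_right₀ one_lt_two, neg_le_neg_iff,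
    neg_le_neg_iff, ← min_le_iff]
  exact HahnSeries.min_order_le_order_add h

/-- `absInf` as a bundled absolute value, which gives access to the general lemmas on absolute
values. -/
def infAbv : AbsoluteValue (SeriesAtInfinity k) ℝ where
  toFun := absInf
  map_mul' F G := by
    by_cases hF : F = 0
    · simp [hF, absInf]
    by_cases hG : G = 0
    · simp [hG, absInf]
    rw [absInf_of_ne_zero hF, absInf_of_ne_zero hG, absInf_of_ne_zero (mul_ne_zero hF hG),
      HahnSeries.order_mul hF hG, neg_add, zpow_add₀ two_ne_zero]
  nonneg' := absInf_nonneg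
  eq_zero' F := by
    rw [absInf]
    split_ifs with hF
    · simp [hF]
    · simpa [hF] using zpow_ne_zero _ two_ne_zero
  add_le' _ _ := isNonarchimedean_absInf.add_le absInf_nonneg

lemma isNonarchimedean_infAbv : IsNonarchimedean (infAbv (k := k)) :=
  isNonarchimedean_absInf

lemma infAbv_of_ne_zero {F : SeriesAtInfinity k} (hF : F ≠ 0) :
    infAbv F = (2 : ℝ) ^ (-F.order) :=
  absInf_of_ne_zero hF

lemma infAbv_lt_one_iff {F : SeriesAtInfinity k} :
    infAbv F < 1 ↔ ∀ h ≤ 0, F.coeff h = 0 := by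
  by_cases hF : F = 0
  · simp [hF]
  rw [infAbv_of_ne_zero hF, zpow_lt_one_iff_right₀ one_lt_two, neg_lt_zero]
  refine ⟨fun h i hi => HahnSeries.coeff_eq_zero_of_lt_order (hi.trans_lt h), fun h => ?_⟩
  by_contra! hle
  exact hF (HahnSeries.coeff_order_eq_zero.1 (h _ hle))

lemma infAbv_seriesX : infAbv (seriesX k) = 2 := by
  rw [infAbv_of_ne_zero (by simp [seriesX]), seriesX, HahnSeries.order_single one_ne_zero]
  norm_num

lemma ofPoly_X : ofPoly (Polynomial.X : Polynomial k) = seriesX k := by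
  simp [ofPoly]

lemma ofPoly_monomial (n : ℕ) (a : k) :
    ofPoly (Polynomial.monomial n a) = HahnSeries.single (-(n : ℤ)) a := by
  simp [ofPoly, seriesX, Polynomial.eval₂_monomial, HahnSeries.C_apply,
    HahnSeries.single_pow, HahnSeries.single_mul_single]

lemma coeff_ofPoly (q : Polynomial k) (h : ℤ) :
    (ofPoly q).coeff h = if h ≤ 0 then q.coeff (-h).toNat else 0 := by
  induction q using Polynomial.induction_on' with
  | add p q hp hq => rw [map_add, HahnSeries.coeff_add, hp, hq]; split_ifs <;> simp
  | monomial n a =>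
    rw [ofPoly_monomial, Polynomial.coeff_monomial, HahnSeries.coeff_single]
    split_ifs <;> first | rfl | omega

lemma order_ofPoly (q : Polynomial k) : (ofPoly q).order = -(q.natDegree : ℤ) := by
  rcases eq_or_ne q 0 with rfl | hq
  · simp
  have hc : (ofPoly q).coeff (-(q.natDegree : ℤ)) ≠ 0 := by
    simpa [coeff_ofPoly] using hq
  refine le_antisymm (HahnSeries.order_le_of_coeff_ne_zero hc) ?_
  rw [HahnSeries.le_order_iff_forall (HahnSeries.ne_zero_of_coeff_ne_zero hc)]
  intro j hj
  rw [coeff_ofPoly, if_pos (by omega)]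
  exact Polynomial.coeff_eq_zero_of_natDegree_lt (by omega)

lemma ofPoly_injective : Function.Injective (ofPoly (k := k)) := by
  refine (injective_iff_map_eq_zero ofPoly).2 fun q hq => ?_
  ext n
  simpa [hq] using (coeff_ofPoly q (-n)).symm

/-- The restriction of `infAbv` to polynomials, `|q| = 2 ^ deg q`. -/
def polyAbv : AbsoluteValue (Polynomial k) ℝ :=
  infAbv.comp ofPoly_injective

lemma isNonarchimedean_polyAbv : IsNonarchimedean (polyAbv (k := k)) := fun p q => by
  change infAbv (ofPoly (p + q)) ≤ _
  rw [map_add]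
  exact isNonarchimedean_infAbv (ofPoly p) (ofPoly q)

lemma infAbv_ofPoly (q : Polynomial k) : infAbv (ofPoly q) = polyAbv q := rfl

lemma polyAbv_of_ne_zero {q : Polynomial k} (hq : q ≠ 0) : polyAbv q = (2 : ℝ) ^ q.natDegree := by
  have hq' : ofPoly q ≠ 0 := (map_ne_zero_iff ofPoly ofPoly_injective).2 hq
  rw [← infAbv_ofPoly, infAbv_of_ne_zero hq', order_ofPoly, neg_neg, zpow_natCast]

lemma one_le_polyAbv (q : Polynomial k) (hq : q ≠ 0) : 1 ≤ polyAbv q := by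
  rw [polyAbv_of_ne_zero hq]
  exact one_le_pow₀ one_le_two

lemma one_lt_polyAbv {q : Polynomial k} (hq : 1 ≤ q.natDegree) : 1 < polyAbv q := by
  rw [polyAbv_of_ne_zero (Polynomial.ne_zero_of_natDegree_gt hq)]
  exact one_lt_pow₀ one_lt_two (Nat.one_le_iff_ne_zero.1 hq)

lemma fracPart_eq_sub {F : SeriesAtInfinity k} {P : Polynomial k}
    (h : infAbv (F - ofPoly P) < 1) : fracPart F = F - ofPoly P := by
  ext i
  change (if 0 < i then F.coeff i else 0) = _
  split_ifs with hi
  · rw [HahnSeries.coeff_sub, coeff_ofPoly, if_neg hi.not_ge, sub_zero]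
  · exact (infAbv_lt_one_iff.1 h i (not_lt.1 hi)).symm

lemma distPoly_eq {F : SeriesAtInfinity k} {P : Polynomial k}
    (h : infAbv (F - ofPoly P) < 1) : distPoly F = infAbv (F - ofPoly P) :=
  congrArg infAbv (fracPart_eq_sub h)

lemma exists_infAbv_sub_ofPoly_lt_one (F : SeriesAtInfinity k) :
    ∃ P : Polynomial k, infAbv (F - ofPoly P) < 1 := by
  refine ⟨∑ i ∈ Finset.range (F.order.natAbs + 1), Polynomial.monomial i (F.coeff (-(i : ℤ))),
    infAbv_lt_one_iff.2 fun i hi => ?_⟩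
  rw [HahnSeries.coeff_sub, coeff_ofPoly, if_pos hi, Polynomial.finsetSum_coeff]
  simp only [Polynomial.coeff_monomial]
  rw [Finset.sum_ite_eq', Int.toNat_of_nonneg (neg_nonneg.2 hi), neg_neg]
  split_ifs with hmem
  · exact sub_self _
  · rw [Finset.mem_range] at hmem
    rw [HahnSeries.coeff_eq_zero_of_lt_order (by omega), sub_self]

lemma natDegree_contMatrix {L : List (Polynomial k)} (hL : ∀ a ∈ L, 1 ≤ a.natDegree) :
    (contMatrix L 0 0).natDegree = (L.map Polynomial.natDegree).sum := by
  have hv := isNonarchimedean_polyAbv (k := k)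
  have hne : ∀ {L : List (Polynomial k)}, (∀ a ∈ L, 1 ≤ a.natDegree) → contMatrix L 0 0 ≠ 0 :=
    fun hL => polyAbv.pos_iff.1 <| (polyAbv.nonneg _).trans_lt <|
      abv_contMatrix_one_lt_zero hv fun a ha => one_lt_polyAbv (hL a ha)
  induction L with
  | nil => simp [contMatrix_nil]
  | cons a L ih =>
    have hL' : ∀ b ∈ L, 1 ≤ b.natDegree := fun b hb => hL b (List.mem_cons_of_mem a hb)
    have h := abv_contMatrix_cons_zero hv fun b hb => one_lt_polyAbv (hL b hb)
    rw [polyAbv_of_ne_zero (hne hL), polyAbv_of_ne_zero (hne hL'),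
      polyAbv_of_ne_zero (Polynomial.ne_zero_of_natDegree_gt (hL a List.mem_cons_self)),
      ← pow_add] at h
    rw [pow_right_injective₀ two_pos (by norm_num) h, ih hL', List.map_cons, List.sum_cons]

end AbsoluteValue

section Convergents

open Polynomial

/-- The first column `q, r` and the last entry `s` of a symmetric matrix `!![q, r; r, s]`; such
triples encode simultaneous approximations `r / q` of `Θ` and `s / q` of `Θ ^ 2`. -/
structure QuarticTriple (R : Type*) where
  q : R
  r : R
  s : R

namespace QuarticTriple

variable {R : Type*} [CommRing R]

/-- The symmetric matrix of a triple. -/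
def toMatrix (t : QuarticTriple R) : Matrix (Fin 2) (Fin 2) R :=
  !![t.q, t.r; t.r, t.s]

/-- The triple is a point of the conic `q² + q s + s² = x q r`, which meets the conic `r² = q s` in
the points `(1 : Z : Z²)` with `Z⁴ + Z² - x Z + 1 = 0`. -/
def OnConic (x : R) (t : QuarticTriple R) : Prop :=
  t.q ^ 2 + t.q * t.s + t.s ^ 2 = x * t.q * t.r

/-- The step from one convergent in the chosen sequence to the next one. -/
def next (x : R) (t : QuarticTriple R) : QuarticTriple R where
  q := x * t.q ^ 3 - 2 * t.q * t.r * t.s - t.q ^ 2 * t.r + t.r ^ 3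
  r := t.q ^ 3
  s := t.r * (t.q ^ 2 + t.r ^ 2 - t.q * t.s)

/-- The matrix `B` for which the matrix `M` of a triple on the conic has successor `M * B * M`. -/
def link (x : R) (t : QuarticTriple R) : Matrix (Fin 2) (Fin 2) R :=
  !![x * t.q + t.r, -(t.q + t.s); -(t.q + t.s), t.r]

lemma OnConic.toMatrix_next {x : R} {t : QuarticTriple R} (ht : t.OnConic x) :
    (t.next x).toMatrix = t.toMatrix * t.link x * t.toMatrix := by
  rw [OnConic] at ht
  simp only [toMatrix, next, link, Matrix.mul_fin_two, EmbeddingLike.apply_eq_iff_eq,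
    Matrix.vecCons_inj, and_true]
  refine ⟨⟨?_, ?_⟩, ?_, ?_⟩
  · ring
  · linear_combination t.q * ht
  · linear_combination t.q * ht
  · linear_combination t.r * ht

variable [CharP R 3]

lemma OnConic.next {x : R} {t : QuarticTriple R} (ht : t.OnConic x) : (t.next x).OnConic x := by
  have h3 : (3 : R) = 0 := CharP.ofNat_eq_zero R 3
  rw [OnConic] at ht ⊢
  simp only [QuarticTriple.next]
  linear_combination t.q ^ 2 * t.r ^ 2 * ht + (t.r ^ 6 - 3 * t.q * t.r ^ 4 * t.s +
    2 * t.q ^ 2 * t.r ^ 2 * t.s ^ 2 + x * t.q ^ 3 * t.r ^ 3 - x * t.q ^ 4 * t.r * t.s) * h3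

lemma OnConic.link_next {x : R} {t : QuarticTriple R} (ht : t.OnConic x) :
    (t.next x).link x = !![-x, 1; 1, 0] * t.toMatrix.map (frobenius R 3) * !![-x, 1; 1, 0] := by
  have h3 : (3 : R) = 0 := CharP.ofNat_eq_zero R 3
  rw [OnConic] at ht
  have hmap : t.toMatrix.map (frobenius R 3) = !![t.q ^ 3, t.r ^ 3; t.r ^ 3, t.s ^ 3] := by
    simp [← Matrix.ext_iff, toMatrix, frobenius_def]
  simp only [hmap, link, QuarticTriple.next, Matrix.mul_fin_two, EmbeddingLike.apply_eq_iff_eq,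
    Matrix.vecCons_inj, and_true]
  refine ⟨⟨?_, ?_⟩, ?_, ?_⟩
  · linear_combination (t.q - t.s) * ht + x * t.r * (t.r ^ 2 - t.q * t.s) * h3
  · linear_combination t.r * (t.q * t.s - t.r ^ 2) * h3
  · linear_combination t.r * (t.q * t.s - t.r ^ 2) * h3
  · ring

end QuarticTriple

variable (k : Type*) [Field k] [CharP k 3]

/-- A sequence of convergents of the root of `Z⁴ + Z² - X Z + 1`. -/
def quarticConvergent : ℕ → QuarticTriple k[X]
  | 0 => ⟨1, 0, 1⟩
  | n + 1 => (quarticConvergent n).next X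

/-- The partial quotients of `quarticConvergent`. -/
def quarticWord : ℕ → List k[X]
  | 0 => []
  | 1 => X :: []
  | n + 2 => quarticWord (n + 1) ++
      -X :: (quarticWord n).map (frobenius k[X] 3) ++ -X :: quarticWord (n + 1)

lemma onConic_quarticConvergent (n : ℕ) : (quarticConvergent k n).OnConic X := by
  induction n with
  | zero =>
    have h3 : (3 : k[X]) = 0 := CharP.ofNat_eq_zero k[X] 3
    rw [QuarticTriple.OnConic, quarticConvergent]
    linear_combination h3
  | succ n ih => exact ih.next

lemma contMatrix_quarticWord (n : ℕ) :
    contMatrix (quarticWord k n) = (quarticConvergent k n).toMatrix := by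
  induction n using Nat.twoStepInduction with
  | zero => rw [quarticWord, contMatrix_nil, Matrix.one_fin_two]; rfl
  | one =>
    rw [quarticWord, contMatrix_cons, contMatrix_nil, mul_one]
    simp [quarticConvergent, QuarticTriple.next, QuarticTriple.toMatrix]
  | more n h₀ h₁ =>
    have hnext := (onConic_quarticConvergent k (n + 1)).toMatrix_next
    have hlink := (onConic_quarticConvergent k n).link_next
    rw [← quarticConvergent] at hnext hlink
    rw [quarticWord, contMatrix_append, contMatrix_append, contMatrix_cons, contMatrix_cons,
      contMatrix_map, h₀, h₁, hnext, hlink]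
    simp only [Matrix.mul_assoc]

variable {k}

lemma natDegree_of_mem_quarticWord {n : ℕ} {a : k[X]} (ha : a ∈ quarticWord k n) :
    1 ≤ a.natDegree ∧ 3 * a.natDegree ^ 2 ≤ 3 ^ n := by
  induction n using Nat.twoStepInduction generalizing a with
  | zero => simp [quarticWord] at ha
  | one =>
    obtain rfl : a = X := by simpa [quarticWord] using ha
    simp
  | more n h₀ h₁ =>
    have hX : 1 ≤ (-X : k[X]).natDegree ∧ 3 * (-X : k[X]).natDegree ^ 2 ≤ 3 ^ (n + 2) := by
      rw [natDegree_neg, natDegree_X, pow_add]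
      have : 1 ≤ 3 ^ n := Nat.one_le_pow _ _ three_pos
      omega
    have h₁' : ∀ {a}, a ∈ quarticWord k (n + 1) →
        1 ≤ a.natDegree ∧ 3 * a.natDegree ^ 2 ≤ 3 ^ (n + 2) :=
      fun ha => ⟨(h₁ ha).1, (h₁ ha).2.trans (Nat.pow_le_pow_right three_pos (by omega))⟩
    simp only [quarticWord, List.mem_append, List.mem_cons, List.mem_map] at ha
    rcases ha with (ha | rfl | ⟨b, hb, rfl⟩) | rfl | ha
    · exact h₁' ha
    · exact hX
    · obtain ⟨hb₁, hb₂⟩ := h₀ hb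
      rw [frobenius_def, natDegree_pow, pow_add]
      exact ⟨by omega, by linarith⟩
    · exact hX
    · exact h₁' ha

lemma sum_natDegree_quarticWord (n : ℕ) :
    2 * ((quarticWord k n).map natDegree).sum + 1 = 3 ^ n := by
  induction n using Nat.twoStepInduction with
  | zero => simp [quarticWord]
  | one => simp [quarticWord]
  | more n h₀ h₁ =>
    have hfrob : (((quarticWord k n).map (frobenius k[X] 3)).map natDegree).sum
        = 3 * ((quarticWord k n).map natDegree).sum := by
      simp [List.map_map, Function.comp_def, frobenius_def, List.sum_map_mul_left]
    simp only [quarticWord, List.map_append, List.map_cons, List.sum_append, List.sum_cons, hfrob,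
      natDegree_neg, natDegree_X]
    rw [pow_succ] at h₁
    rw [pow_add]
    omega

lemma natDegree_quarticConvergent (n : ℕ) :
    2 * (quarticConvergent k n).q.natDegree + 1 = 3 ^ n := by
  have h := natDegree_contMatrix fun a (ha : a ∈ quarticWord k n) =>
    (natDegree_of_mem_quarticWord ha).1
  rw [contMatrix_quarticWord] at h
  rw [← sum_natDegree_quarticWord (k := k), ← h]
  rfl

lemma polyAbv_quarticConvergent_lt (n : ℕ) :
    polyAbv (quarticConvergent k n).r < polyAbv (quarticConvergent k n).q := by
  have h := abv_contMatrix_one_lt_zero isNonarchimedean_polyAbv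
    fun a (ha : a ∈ quarticWord k n) => one_lt_polyAbv (natDegree_of_mem_quarticWord ha).1
  rwa [contMatrix_quarticWord] at h

lemma quarticConvergent_q_ne_zero (n : ℕ) : (quarticConvergent k n).q ≠ 0 :=
  polyAbv.pos_iff.1 ((polyAbv.nonneg _).trans_lt (polyAbv_quarticConvergent_lt n))

lemma polyAbv_det_quarticConvergent (n : ℕ) :
    polyAbv ((quarticConvergent k n).q * (quarticConvergent k n).s -
      (quarticConvergent k n).r ^ 2) = 1 := by
  have h := det_contMatrix (quarticWord k n)
  rw [contMatrix_quarticWord, QuarticTriple.toMatrix, Matrix.det_fin_two_of, ← pow_two] at h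
  rw [h, map_pow, polyAbv.map_neg, map_one, one_pow]

end Convergents

section Root

variable {k : Type*} [Field k]

/-- The polynomial function `Z⁴ + Z² - X Z + 1` on `k((X⁻¹))`. -/
def quartic (Z : SeriesAtInfinity k) : SeriesAtInfinity k :=
  Z ^ 4 + Z ^ 2 - seriesX k * Z + 1

/-- The reversed equation, in the coordinates `u = X⁻¹` and `v = (X Z)⁻¹`. -/
lemma exists_powerSeries_root : ∃ v : PowerSeries k, v ≠ 0 ∧
    v ^ 4 - v ^ 3 + PowerSeries.X ^ 2 * v ^ 2 + PowerSeries.X ^ 4 = 0 := by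
  set u : PowerSeries k := PowerSeries.X with hu
  let f : Polynomial (PowerSeries k) := .X ^ 4 - .X ^ 3 + .C (u ^ 2) * .X ^ 2 + .C (u ^ 4)
  have hmonic : f.Monic := by
    simp only [f]
    monicity!
  have heval : f.eval 1 ∈ Ideal.span {u} :=
    Ideal.mem_span_singleton.2 ⟨u + u ^ 3, by simp [f]; ring⟩
  have hderiv : Ideal.Quotient.mk (Ideal.span {u}) (f.derivative.eval 1) = 1 := by
    rw [← map_one (Ideal.Quotient.mk _), Ideal.Quotient.eq, Ideal.mem_span_singleton]
    exact ⟨u * 2, by simp [f, Polynomial.derivative_pow]; ring⟩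
  obtain ⟨v, hroot, hv⟩ := HenselianRing.is_henselian f hmonic 1 heval (hderiv ▸ isUnit_one)
  refine ⟨v, ?_, by simpa [f, Polynomial.IsRoot] using hroot⟩
  rintro rfl
  simp [hu, Ideal.mem_span_singleton, PowerSeries.X_dvd_iff] at hv

lemma exists_quartic_eq_zero : ∃ Θ : SeriesAtInfinity k, quartic Θ = 0 := by
  obtain ⟨v, hv, hroot⟩ := exists_powerSeries_root (k := k)
  let φ := HahnSeries.ofPowerSeries ℤ k
  have hφv : φ v ≠ 0 := (map_ne_zero_iff φ HahnSeries.ofPowerSeries_injective).2 hv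
  have hX : seriesX k * φ PowerSeries.X = 1 := by
    simp [φ, HahnSeries.ofPowerSeries_X, seriesX, HahnSeries.single_mul_single]
  have hφroot := congrArg φ hroot
  simp only [map_add, map_sub, map_mul, map_pow, map_zero] at hφroot
  refine ⟨φ PowerSeries.X / φ v, ?_⟩
  rw [quartic]
  field_simp
  linear_combination hφroot - φ v ^ 3 * hX

/-- On the unit ball the term `-X Z` dominates the variation of the quartic. -/
lemma infAbv_quartic_sub {Z W : SeriesAtInfinity k} (hZ : infAbv Z ≤ 1) (hW : infAbv W ≤ 1) :
    infAbv (quartic Z - quartic W) = 2 * infAbv (Z - W) := by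
  have hv := isNonarchimedean_infAbv (k := k)
  have hadd : infAbv (Z + W) ≤ 1 := abv_add_le hv hZ hW
  have hsq : infAbv (Z ^ 2 + W ^ 2 + 1) ≤ 1 := by
    refine abv_add_le hv (abv_add_le hv ?_ ?_) infAbv.map_one.le
    · rw [map_pow]; exact pow_le_one₀ (infAbv.nonneg Z) hZ
    · rw [map_pow]; exact pow_le_one₀ (infAbv.nonneg W) hW
  have hfactor : quartic Z - quartic W =
      ((Z + W) * (Z ^ 2 + W ^ 2 + 1) - seriesX k) * (Z - W) := by
    rw [quartic, quartic]; ring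
  rw [hfactor, map_mul, abv_sub_eq_right_of_lt hv, infAbv_seriesX]
  rw [infAbv_seriesX, map_mul]
  exact (mul_le_one₀ hadd (infAbv.nonneg _) hsq).trans_lt one_lt_two

lemma infAbv_le_one_of_quartic_eq_zero {Θ : SeriesAtInfinity k} (hΘ : quartic Θ = 0) :
    infAbv Θ ≤ 1 := by
  have hv := isNonarchimedean_infAbv (k := k)
  by_contra! hlt
  have hΘ₀ : Θ ≠ 0 := infAbv.pos_iff.1 (one_pos.trans hlt)
  have hlow : infAbv (Θ ^ 2 + 1) < infAbv (Θ ^ 4) := by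
    rw [map_pow infAbv Θ 4]
    refine (abv_add_le hv (map_pow infAbv Θ 2).le ?_).trans_lt
      (pow_lt_pow_right₀ hlt (by norm_num))
    rw [infAbv.map_one]
    exact one_le_pow₀ hlt.le
  have hquartic : infAbv Θ ^ 4 = 2 * infAbv Θ := by
    rw [← map_pow, ← abv_add_eq_left_of_lt hv hlow, ← infAbv_seriesX (k := k), ← map_mul]
    congr 1
    rw [quartic] at hΘ
    linear_combination hΘ
  have hcube : infAbv Θ ^ 3 = 2 :=
    mul_right_cancel₀ (one_pos.trans hlt).ne' (by rw [← hquartic]; ring)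
  rw [infAbv_of_ne_zero hΘ₀, ← zpow_natCast, ← zpow_mul] at hcube
  have := zpow_right_injective₀ two_pos (by norm_num) (hcube.trans (zpow_one (2 : ℝ)).symm)
  omega

lemma eq_of_quartic_eq_zero {Θ Θ' : SeriesAtInfinity k} (hΘ : quartic Θ = 0)
    (hΘ' : quartic Θ' = 0) : Θ = Θ' := by
  have h := infAbv_quartic_sub (infAbv_le_one_of_quartic_eq_zero hΘ)
    (infAbv_le_one_of_quartic_eq_zero hΘ')
  simpa [hΘ, hΘ', sub_eq_zero] using h

lemma infAbv_eq_of_quartic_eq_zero {Θ : SeriesAtInfinity k} (hΘ : quartic Θ = 0) :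
    infAbv Θ = 1 / 2 := by
  have h := infAbv_quartic_sub (W := 0) (infAbv_le_one_of_quartic_eq_zero hΘ) (by simp)
  have h₀ : quartic (0 : SeriesAtInfinity k) = 1 := by simp [quartic]
  rw [hΘ, h₀, zero_sub, infAbv.map_neg, infAbv.map_one, sub_zero] at h
  linarith

lemma infAbv_mul_inv_sub {Θ : SeriesAtInfinity k} (hΘ : quartic Θ = 0)
    (F G : SeriesAtInfinity k) : infAbv (F * Θ⁻¹ - G) = 2 * infAbv (G * Θ - F) := by
  have hΘ₀ : Θ ≠ 0 := by
    rintro rfl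
    simp [quartic] at hΘ
  have h : F * Θ⁻¹ - G = -((G * Θ - F) * Θ⁻¹) := by
    field_simp
    ring
  rw [h, infAbv.map_neg, map_mul, map_inv₀, infAbv_eq_of_quartic_eq_zero hΘ]
  ring

lemma infAbv_mul_sub_le {Θ : SeriesAtInfinity k} (hΘ : quartic Θ = 0)
    {t : QuarticTriple (SeriesAtInfinity k)} (hconic : t.OnConic (seriesX k))
    (hdet : infAbv (t.q * t.s - t.r ^ 2) = 1) (hq : 1 ≤ infAbv t.q)
    (hr : infAbv t.r ≤ infAbv t.q) :
    infAbv t.q * infAbv (t.q * Θ - t.r) ≤ 1 / 2 := by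
  obtain ⟨q, r, s⟩ := t
  dsimp only [QuarticTriple.OnConic] at *
  have hv := isNonarchimedean_infAbv (k := k)
  have hqpos : 0 < infAbv q := one_pos.trans_le hq
  have hq₀ : q ≠ 0 := infAbv.pos_iff.1 hqpos
  set δ := q * s - r ^ 2 with hδ
  have hvalue : q ^ 4 * quartic (r / q) = -δ * (q ^ 2 + (r ^ 2 + (r ^ 2 + δ))) := by
    rw [quartic]
    field_simp
    linear_combination q ^ 2 * hconic + (q ^ 2 + r ^ 2 + q * s + δ) * hδ
  have hsum : infAbv (q ^ 2 + (r ^ 2 + (r ^ 2 + δ))) ≤ infAbv q ^ 2 := by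
    have hr₂ : infAbv (r ^ 2) ≤ infAbv q ^ 2 := by
      rw [map_pow]
      exact pow_le_pow_left₀ (infAbv.nonneg r) hr 2
    exact abv_add_le hv (map_pow _ _ _).le
      (abv_add_le hv hr₂ (abv_add_le hv hr₂ (hdet.trans_le (one_le_pow₀ hq))))
  have hquot : infAbv (r / q) ≤ 1 := by
    rw [map_div₀]
    exact div_le_one_of_le₀ hr hqpos.le
  have hdist := infAbv_quartic_sub (infAbv_le_one_of_quartic_eq_zero hΘ) hquot
  rw [hΘ, zero_sub, infAbv.map_neg] at hdist
  have hscale : infAbv (q * Θ - r) = infAbv q * infAbv (Θ - r / q) := by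
    rw [← map_mul, mul_sub, mul_div_cancel₀ _ hq₀]
  have hbound : infAbv q ^ 4 * (2 * infAbv (Θ - r / q)) ≤ infAbv q ^ 2 := by
    rw [← hdist, ← map_pow, ← map_mul, hvalue, map_mul, infAbv.map_neg, hdet, one_mul]
    exact hsum
  rw [hscale]
  refine le_of_mul_le_mul_left ?_ (pow_pos hqpos 2)
  linarith

end Root

section Approximation

open Polynomial

variable {k : Type*} [Field k] [CharP k 3] {Θ : SeriesAtInfinity k}

lemma infAbv_quarticConvergent_mul_sub_le (hΘ : quartic Θ = 0) (n : ℕ) :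
    polyAbv (quarticConvergent k n).q *
      infAbv (ofPoly (quarticConvergent k n).q * Θ - ofPoly (quarticConvergent k n).r) ≤ 1 / 2 := by
  have hconic := onConic_quarticConvergent k n
  have hdet := polyAbv_det_quarticConvergent (k := k) n
  have hr := (polyAbv_quarticConvergent_lt (k := k) n).le
  have hq := one_le_polyAbv _ (quarticConvergent_q_ne_zero (k := k) n)
  generalize quarticConvergent k n = t at *
  obtain ⟨q, r, s⟩ := t
  refine infAbv_mul_sub_le (t := ⟨ofPoly q, ofPoly r, ofPoly s⟩) hΘ ?_ ?_ hq hr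
  · simpa [QuarticTriple.OnConic, ofPoly_X] using congrArg ofPoly hconic
  · simpa [← infAbv_ofPoly] using hdet

lemma mul_distPoly_mul_distPoly_quarticConvergent_le_one (hΘ : quartic Θ = 0) (n : ℕ) :
    polyAbv (quarticConvergent k (n + 1)).r ^ 2 *
      distPoly (ofPoly (quarticConvergent k (n + 1)).r * Θ) *
      distPoly (ofPoly (quarticConvergent k (n + 1)).r * Θ⁻¹) ≤ 1 := by
  have hv := isNonarchimedean_infAbv (k := k)
  have happrox := infAbv_quarticConvergent_mul_sub_le hΘ (n + 1)
  have hdet := polyAbv_det_quarticConvergent (k := k) (n + 1)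
  have hr := (polyAbv_quarticConvergent_lt (k := k) (n + 1)).le
  have hdeg : 1 ≤ (quarticConvergent k (n + 1)).q.natDegree := by
    have h := natDegree_quarticConvergent (k := k) (n + 1)
    have h₁ : 1 ≤ 3 ^ n := Nat.one_le_pow _ _ three_pos
    rw [pow_succ] at h
    omega
  have hq : 1 < polyAbv _ := one_lt_polyAbv hdeg
  generalize quarticConvergent k (n + 1) = t at *
  obtain ⟨q, r, s⟩ := t
  dsimp only at *
  have hqpos : 0 < polyAbv q := one_pos.trans hq
  have hinv : infAbv (ofPoly r * Θ⁻¹ - ofPoly q) ≤ 1 / polyAbv q := by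
    rw [infAbv_mul_inv_sub hΘ, le_div_iff₀ hqpos]
    linarith
  have hdir : infAbv (ofPoly r * Θ - ofPoly s) ≤ 1 / polyAbv q := by
    have hsplit : ofPoly q * (ofPoly r * Θ - ofPoly s) =
        ofPoly r * (ofPoly q * Θ - ofPoly r) - ofPoly (q * s - r ^ 2) := by
      simp only [map_sub, map_mul, map_pow]
      ring
    rw [le_div_iff₀' hqpos, ← infAbv_ofPoly, ← map_mul, hsplit]
    refine abv_sub_le hv ?_ hdet.le
    rw [map_mul]
    have := mul_le_mul_of_nonneg_right hr (infAbv.nonneg (ofPoly q * Θ - ofPoly r))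
    exact this.trans (happrox.trans (by norm_num))
  have hlt : 1 / polyAbv q < 1 := (div_lt_one hqpos).2 hq
  rw [distPoly_eq (hinv.trans_lt hlt), distPoly_eq (hdir.trans_lt hlt), mul_assoc]
  calc _ ≤ polyAbv q ^ 2 * (1 / polyAbv q * (1 / polyAbv q)) := by
        gcongr
    _ = 1 := by field_simp

lemma exists_le_natDegree_mul_distPoly_le_one (hΘ : quartic Θ = 0) (N : ℕ) :
    ∃ Q : k[X], N ≤ Q.natDegree ∧
      polyAbv Q ^ 2 * distPoly (ofPoly Q * Θ) * distPoly (ofPoly Q * Θ⁻¹) ≤ 1 := by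
  refine ⟨_, ?_, mul_distPoly_mul_distPoly_quarticConvergent_le_one hΘ N⟩
  have hdeg := natDegree_quarticConvergent (k := k) N
  have hN : N < 3 ^ N := Nat.lt_pow_self (by norm_num)
  change N ≤ ((quarticConvergent k N).q ^ 3).natDegree
  rw [natDegree_pow]
  omega

lemma polyAbv_le_of_mem_quarticWord {d : ℕ} {a : k[X]}
    (ha : a ∈ quarticWord k (Nat.log 3 (2 * d + 1) + 1)) :
    polyAbv a ≤ (2 : ℝ) ^ √(2 * d + 1 : ℝ) := by
  obtain ⟨ha₁, ha₂⟩ := natDegree_of_mem_quarticWord ha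
  have hlog : 3 ^ Nat.log 3 (2 * d + 1) ≤ 2 * d + 1 := Nat.pow_log_le_self 3 (by omega)
  rw [polyAbv_of_ne_zero (ne_zero_of_natDegree_gt ha₁), ← Real.rpow_natCast]
  refine Real.rpow_le_rpow_of_exponent_le one_le_two (Real.le_sqrt_of_sq_le ?_)
  rw [pow_succ 3] at ha₂
  exact_mod_cast (by omega : a.natDegree ^ 2 ≤ 2 * d + 1)

lemma polyAbv_lt_quarticConvergent {Q : k[X]} (hQ : Q ≠ 0) :
    polyAbv Q < polyAbv (quarticConvergent k (Nat.log 3 (2 * Q.natDegree + 1) + 1)).q := by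
  rw [polyAbv_of_ne_zero hQ, polyAbv_of_ne_zero (quarticConvergent_q_ne_zero _)]
  refine pow_lt_pow_right₀ one_lt_two ?_
  have hdeg := natDegree_quarticConvergent (k := k) (Nat.log 3 (2 * Q.natDegree + 1) + 1)
  have hlog := Nat.lt_pow_succ_log_self (b := 3) (by norm_num) (2 * Q.natDegree + 1)
  omega

/-- The first convergent whose denominator has degree larger than `deg Q` has partial quotients of
degree at most `√(2 deg Q + 1)`. -/
lemma one_le_mul_infAbv_mul_sub (hΘ : quartic Θ = 0) {Q : k[X]} (hQ : Q ≠ 0) (P : k[X]) :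
    1 ≤ 2 ^ √(2 * Q.natDegree + 1 : ℝ) * polyAbv Q * infAbv (ofPoly Q * Θ - ofPoly P) := by
  have hv := isNonarchimedean_infAbv (k := k)
  have hQq := polyAbv_lt_quarticConvergent hQ
  have happrox := infAbv_quarticConvergent_mul_sub_le hΘ (Nat.log 3 (2 * Q.natDegree + 1) + 1)
  have hgap := abv_contMatrix_le_mul isNonarchimedean_polyAbv one_le_polyAbv
    (fun a ha => ⟨one_lt_polyAbv (natDegree_of_mem_quarticWord ha).1,
      polyAbv_le_of_mem_quarticWord ha⟩) hQ (by rwa [contMatrix_quarticWord]) P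
  rw [contMatrix_quarticWord] at hgap
  generalize quarticConvergent k _ = t at *
  obtain ⟨q, r, s⟩ := t
  change polyAbv q ≤ polyAbv (Q * r - P * q) * polyAbv Q * _ at hgap
  dsimp only at happrox hQq
  have hqpos : 0 < polyAbv q := (polyAbv.nonneg Q).trans_lt hQq
  have hne : Q * r - P * q ≠ 0 := by
    intro h
    rw [h, map_zero, zero_mul, zero_mul] at hgap
    exact hqpos.not_ge hgap
  have hsmall : infAbv (ofPoly Q * (ofPoly q * Θ - ofPoly r)) < 1 := by
    rw [map_mul]
    have := mul_le_mul_of_nonneg_right hQq.le (infAbv.nonneg (ofPoly q * Θ - ofPoly r))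
    exact this.trans_lt (happrox.trans_lt (by norm_num))
  have hsplit : ofPoly q * (ofPoly Q * Θ - ofPoly P) =
      ofPoly (Q * r - P * q) + ofPoly Q * (ofPoly q * Θ - ofPoly r) := by
    simp only [map_sub, map_mul]
    ring
  have hcross : polyAbv (Q * r - P * q) = polyAbv q * infAbv (ofPoly Q * Θ - ofPoly P) := by
    rw [← infAbv_ofPoly q, ← map_mul, hsplit]
    exact (abv_add_eq_left_of_lt hv (hsmall.trans_le (one_le_polyAbv _ hne))).symm
  rw [hcross] at hgap
  refine le_of_mul_le_mul_left ?_ hqpos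
  linarith

lemma one_le_mul_distPoly_mul (hΘ : quartic Θ = 0) {Q : k[X]} (hQ : Q ≠ 0) :
    1 ≤ 2 ^ √(2 * Q.natDegree + 1 : ℝ) * polyAbv Q * distPoly (ofPoly Q * Θ) := by
  obtain ⟨P, hP⟩ := exists_infAbv_sub_ofPoly_lt_one (ofPoly Q * Θ)
  rw [distPoly_eq hP]
  exact one_le_mul_infAbv_mul_sub hΘ hQ P

lemma one_le_mul_distPoly_mul_inv (hΘ : quartic Θ = 0) {Q : k[X]} (hQ : Q ≠ 0) :
    1 ≤ 2 ^ √(2 * Q.natDegree + 3 : ℝ) * polyAbv Q * distPoly (ofPoly Q * Θ⁻¹) := by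
  obtain ⟨P, hP⟩ := exists_infAbv_sub_ofPoly_lt_one (ofPoly Q * Θ⁻¹)
  have hvalue : infAbv (ofPoly Q * Θ⁻¹) = 2 * polyAbv Q := by
    rw [map_mul, map_inv₀, infAbv_eq_of_quartic_eq_zero hΘ, infAbv_ofPoly]
    ring
  have hPQ : polyAbv P = 2 * polyAbv Q := by
    have hQ₁ := one_le_polyAbv Q hQ
    rw [← hvalue, ← infAbv_ofPoly, ← sub_sub_cancel (ofPoly Q * Θ⁻¹) (ofPoly P),
      abv_sub_eq_left_of_lt isNonarchimedean_infAbv (by linarith)]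
  have hP₀ : P ≠ 0 := polyAbv.pos_iff.1 (hPQ ▸ mul_pos two_pos (polyAbv.pos hQ))
  have hdeg : P.natDegree = Q.natDegree + 1 := by
    rw [polyAbv_of_ne_zero hP₀, polyAbv_of_ne_zero hQ, ← pow_succ'] at hPQ
    exact pow_right_injective₀ two_pos (by norm_num) hPQ
  have h := one_le_mul_infAbv_mul_sub hΘ hP₀ Q
  rw [hPQ, hdeg] at h
  rw [distPoly_eq hP, infAbv_mul_inv_sub hΘ]
  convert h using 1
  push_cast
  ring_nf

lemma one_le_mul_distPoly_mul_distPoly (hΘ : quartic Θ = 0) {Q : k[X]} (hQ : Q ≠ 0) :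
    1 ≤ 2 ^ (2 * √(2 * Q.natDegree + 3 : ℝ)) * polyAbv Q ^ 2 *
      distPoly (ofPoly Q * Θ) * distPoly (ofPoly Q * Θ⁻¹) := by
  have hmono : (2 : ℝ) ^ √(2 * Q.natDegree + 1 : ℝ) ≤ 2 ^ √(2 * Q.natDegree + 3 : ℝ) := by
    gcongr <;> norm_num
  have hΘ₁ := one_le_mul_distPoly_mul hΘ hQ
  have hΘ₂ := one_le_mul_distPoly_mul_inv hΘ hQ
  have hd : 0 ≤ distPoly (ofPoly Q * Θ) := absInf_nonneg _
  calc 1 ≤ (2 ^ √(2 * Q.natDegree + 3 : ℝ) * polyAbv Q * distPoly (ofPoly Q * Θ)) *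
        (2 ^ √(2 * Q.natDegree + 3 : ℝ) * polyAbv Q * distPoly (ofPoly Q * Θ⁻¹)) := by
        refine one_le_mul_of_one_le_of_one_le (hΘ₁.trans ?_) hΘ₂
        gcongr
    _ = _ := by
        rw [two_mul (√_), Real.rpow_add two_pos]
        ring

lemma two_mul_sqrt_le_mul {d ε : ℝ} (hε : 0 < ε) (hd : 1 ≤ d) (hεd : 20 / ε ^ 2 ≤ d) :
    2 * √(2 * d + 3) ≤ ε * d := by
  rw [div_le_iff₀ (by positivity)] at hεd
  rw [← le_div_iff₀' two_pos]
  refine Real.sqrt_le_iff.2 ⟨by positivity, ?_⟩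
  nlinarith

lemma one_le_rpow_mul_distPoly_mul_distPoly (hΘ : quartic Θ = 0) {ε : ℝ} (hε : 0 < ε) {Q : k[X]}
    (hQ : 1 ≤ Q.natDegree) (hQε : 20 / ε ^ 2 ≤ Q.natDegree) :
    1 ≤ polyAbv Q ^ (2 + ε) * distPoly (ofPoly Q * Θ) * distPoly (ofPoly Q * Θ⁻¹) := by
  have hQ₀ : Q ≠ 0 := ne_zero_of_natDegree_gt hQ
  have hd : 0 ≤ distPoly (ofPoly Q * Θ) := absInf_nonneg _
  have hd' : 0 ≤ distPoly (ofPoly Q * Θ⁻¹) := absInf_nonneg _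
  have hsqrt : (2 : ℝ) ^ (2 * √(2 * Q.natDegree + 3 : ℝ)) ≤ polyAbv Q ^ ε := by
    rw [polyAbv_of_ne_zero hQ₀, ← Real.rpow_natCast_mul two_pos.le]
    refine Real.rpow_le_rpow_of_exponent_le one_le_two ?_
    rw [mul_comm _ ε]
    exact two_mul_sqrt_le_mul hε (by exact_mod_cast hQ) hQε
  refine (one_le_mul_distPoly_mul_distPoly hΘ hQ₀).trans ?_
  rw [Real.rpow_add (polyAbv.pos hQ₀), Real.rpow_two, mul_comm (polyAbv Q ^ 2)]
  gcongr

end Approximation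

end PowerSeriesField

end

open PowerSeriesField in
theorem theorem9_general {k : Type*} [Field k] [CharP k 3] :
    (∃! Θ : SeriesAtInfinity k,
      Θ ^ 4 + Θ ^ 2 - seriesX k * Θ + 1 = 0) ∧
    ∀ Θ : SeriesAtInfinity k,
      Θ ^ 4 + Θ ^ 2 - seriesX k * Θ + 1 = 0 →
      (⨅ q : {q : Polynomial k // q ≠ 0},
        ENNReal.ofReal
          (absInf (ofPoly q.1) ^ 2 *
            distPoly (ofPoly q.1 * Θ) *
            distPoly (ofPoly q.1 * Θ⁻¹))) < ⊤ ∧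
      liminf (fun q : Polynomial k =>
        ENNReal.ofReal
          (absInf (ofPoly q) ^ 2 *
            distPoly (ofPoly q * Θ) *
            distPoly (ofPoly q * Θ⁻¹)))
        (comap Polynomial.natDegree atTop) < ⊤ ∧
      ∀ ε : ℝ, 0 < ε → ∃ D : ℕ, ∀ q : Polynomial k, D ≤ q.natDegree →
        1 ≤ absInf (ofPoly q) ^
              (2 + 4 / Real.sqrt (3 * (q.natDegree : ℝ)) + ε) *
            distPoly (ofPoly q * Θ) *
            distPoly (ofPoly q * Θ⁻¹) := by
  obtain ⟨Θ₀, hΘ₀⟩ := exists_quartic_eq_zero (k := k)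
  refine ⟨⟨Θ₀, hΘ₀, fun Θ hΘ => eq_of_quartic_eq_zero hΘ hΘ₀⟩, fun Θ hΘ => ⟨?_, ?_, fun ε hε => ?_⟩⟩
  · exact (iInf_le _ ⟨1, one_ne_zero⟩).trans_lt ENNReal.ofReal_lt_top
  · refine (liminf_le_of_frequently_le' (x := 1) ?_).trans_lt ENNReal.one_lt_top
    refine (atTop_basis.comap _).frequently_iff.2 fun {N} _ => ?_
    obtain ⟨Q, hQN, hQ⟩ := exists_le_natDegree_mul_distPoly_le_one hΘ N
    exact ⟨Q, hQN, ENNReal.ofReal_le_one.2 hQ⟩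
  · refine ⟨⌈20 / ε ^ 2⌉₊ + 1, fun Q hQ => ?_⟩
    have hQ₁ : 1 ≤ Q.natDegree := le_of_add_le_right hQ
    have hexp : ε ≤ 4 / √(3 * Q.natDegree : ℝ) + ε := le_add_of_nonneg_left (by positivity)
    rw [add_assoc]
    refine one_le_rpow_mul_distPoly_mul_distPoly hΘ (hε.trans_le hexp) hQ₁ ?_
    calc 20 / (4 / √(3 * Q.natDegree : ℝ) + ε) ^ 2 ≤ 20 / ε ^ 2 := by gcongr
      _ ≤ (Q.natDegree : ℝ) := Nat.le_of_ceil_le (le_of_add_le_left hQ)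

theorem theorem9 :
    -- the polynomial `Z⁴ + Z² - X Z + 1` has a unique root in `𝔽₃((X⁻¹))`
    (∃! Θ : PowerSeriesField.SeriesAtInfinity (ZMod 3),
      Θ ^ 4 + Θ ^ 2 - PowerSeriesField.seriesX (ZMod 3) * Θ + 1 = 0) ∧
    ∀ Θ : PowerSeriesField.SeriesAtInfinity (ZMod 3),
      Θ ^ 4 + Θ ^ 2 - PowerSeriesField.seriesX (ZMod 3) * Θ + 1 = 0 →
      -- the infimum over nonzero `q` is finite
      (⨅ q : {q : Polynomial (ZMod 3) // q ≠ 0},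
        ENNReal.ofReal
          (PowerSeriesField.absInf (PowerSeriesField.ofPoly q.1) ^ 2 *
            PowerSeriesField.distPoly (PowerSeriesField.ofPoly q.1 * Θ) *
            PowerSeriesField.distPoly (PowerSeriesField.ofPoly q.1 * Θ⁻¹))) < ⊤ ∧
      -- the lower limit as `deg q → ∞` is finite
      liminf (fun q : Polynomial (ZMod 3) =>
        ENNReal.ofReal
          (PowerSeriesField.absInf (PowerSeriesField.ofPoly q) ^ 2 *
            PowerSeriesField.distPoly (PowerSeriesField.ofPoly q * Θ) *
            PowerSeriesField.distPoly (PowerSeriesField.ofPoly q * Θ⁻¹)))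
        (comap Polynomial.natDegree atTop) < ⊤ ∧
      -- the lower bound for all `q` of large degree
      ∀ ε : ℝ, 0 < ε → ∃ D : ℕ, ∀ q : Polynomial (ZMod 3), D ≤ q.natDegree →
        1 ≤ PowerSeriesField.absInf (PowerSeriesField.ofPoly q) ^
              (2 + 4 / Real.sqrt (3 * (q.natDegree : ℝ)) + ε) *
            PowerSeriesField.distPoly (PowerSeriesField.ofPoly q * Θ) *
            PowerSeriesField.distPoly (PowerSeriesField.ofPoly q * Θ⁻¹) := by
  exact theorem9_general
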